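/- Fix a laziness parameter $\varepsilon\in(0,1)$. Let $Y_n=\xi_1+\dots+\xi_n$ ($Y_0=0$) be the lazy simple random walk on $\mathbb{Z}$, where $\xi_1,\xi_2,\dots$ are i.i.d. with $\mathbb{P}(\xi_i=0)=\varepsilon$ and $\mathbb{P}(\xi_i=1)=\mathbb{P}(\xi_i=-1)=\frac{1-\varepsilon}{2}$, and let $p_n(k)=\mathbb{P}(Y_n=k)$ for $n\in\mathbb{N}=\{0,1,2,\dots\}$, $k\in\mathbb{Z}$. For $\delta>0$ define the rescaled kernel $$\hat p^{\delta}_t(x)=\frac1\delta\,p_{t/\delta^2}(x/\delta),\qquad (t,x)\in\delta^2\mathbb{N}\times\delta\mathbb{Z},$$ and, for functions $f$ on $\delta\mathbb{Z}$, the discrete gradients $$\nabla^{2,\delta}f(x)=\frac{1}{\delta^2}\big(f(x+\delta)+f(x-\delta)-2f(x)\big),$$ $$\nabla^{4,\delta}f(x)=\frac{1}{\delta^4}\big(f(x+2\delta)-4f(x+\delta)+6f(x)-4f(x-\delta)+f(x-2\delta)\big).$$ Then for each $m\in\{2,4\}$ there exist constants $C_1,C_2,C>0$, depending only on $m$ and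 $\varepsilon$, such that for all $\delta>0$: (i) for all $(t,u)\in\delta^2\mathbb{N}\times\delta\mathbb{Z}$ with $t>0$, $$\big|\nabla^{m,\delta}\hat p^{\delta}_t(u)\big|\le\frac{C_1}{t^{(m+1)/2}}\,e^{-C_2u^2/t};$$ (ii) for $t=0$ and all $u\in\delta\mathbb{Z}$, $$\big|\nabla^{m,\delta}\hat p^{\delta}_0(u)\big|\le\frac{C}{\delta^{m+1}}\,\mathbf{1}_{\{|u|\le m\delta/2\}}.$$ -/

import Mathlib

open MeasureTheory Set

noncomputable section

namespace LazyWalk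

/-- The law of one step `ξ` of the lazy simple random walk on `ℤ` with laziness parameter `ε`:
`P(ξ = 0) = ε` and `P(ξ = 1) = P(ξ = -1) = (1 - ε) / 2`. -/
def stepLaw (ε : ℝ) : Measure ℤ :=
  ENNReal.ofReal ε • Measure.dirac 0
    + ENNReal.ofReal ((1 - ε) / 2) • Measure.dirac 1
    + ENNReal.ofReal ((1 - ε) / 2) • Measure.dirac (-1)

/-- The law of `Y_n = ξ₁ + ⋯ + ξ_n` (so `Y_0 = 0`) with `ξ₁, …, ξ_n` i.i.d. of law `stepLaw ε`:
the `n`-fold convolution power of the step law. -/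
def walkLaw (ε : ℝ) : ℕ → Measure ℤ
  | 0 => Measure.dirac 0
  | n + 1 => (walkLaw ε n).conv (stepLaw ε)

/-- The `n`-step transition function `p_n(k) = P(Y_n = k | Y_0 = 0)`. -/
def kernel (ε : ℝ) (n : ℕ) (k : ℤ) : ℝ := (walkLaw ε n).real {k}

/-- The time grid `δ² ℕ`, with `0` included. -/
def timeGrid (δ : ℝ) : Set ℝ := range fun n : ℕ => δ ^ 2 * (n : ℝ)

/-- The space grid `δ ℤ`. -/
def spaceGrid (δ : ℝ) : Set ℝ := range fun k : ℤ => δ * (k : ℝ)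

/-- The rescaled kernel `δ⁻¹ p_{t/δ²}(x/δ)`. On the grid `δ² ℕ × δ ℤ` the quotients `t / δ²` and
`x / δ` are integers and the floors only turn these reals into elements of `ℕ` and `ℤ`
(see `rescaledKernel_grid`); no other values are used. -/
def rescaledKernel (ε δ t x : ℝ) : ℝ := (1 / δ) * kernel ε ⌊t / δ ^ 2⌋₊ ⌊x / δ⌋

theorem rescaledKernel_grid (ε : ℝ) {δ : ℝ} (hδ : 0 < δ) (n : ℕ) (k : ℤ) :
    rescaledKernel ε δ (δ ^ 2 * (n : ℝ)) (δ * (k : ℝ)) = (1 / δ) * kernel ε n k := by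
  have h1 : δ ^ 2 * (n : ℝ) / δ ^ 2 = n := mul_div_cancel_left₀ _ (pow_ne_zero 2 hδ.ne')
  have h2 : δ * (k : ℝ) / δ = k := mul_div_cancel_left₀ _ hδ.ne'
  rw [rescaledKernel, h1, h2, Nat.floor_natCast, Int.floor_intCast]

/-- The rescaled second order discrete gradient. -/
def grad2 (δ : ℝ) (f : ℝ → ℝ) (x : ℝ) : ℝ :=
  (1 / δ ^ 2) * (f (x + δ) + f (x - δ) - 2 * f x)

/-- The rescaled fourth order discrete gradient. -/
def grad4 (δ : ℝ) (f : ℝ → ℝ) (x : ℝ) : ℝ :=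
  (1 / δ ^ 4) *
    (f (x + 2 * δ) - 4 * f (x + δ) + 6 * f x - 4 * f (x - δ) + f (x - 2 * δ))

end LazyWalk

end

namespace LazyWalk

/-! ### The transition function: recursion, support -/

/-! Write φ(z) = ε + (1 - ε) cosh z. For every real r, 2π p_n(k) is the integral of φ(z)^n e^{-kz}
over z = r + iθ, |θ| ≤ π, and each second difference in k multiplies the integrand by 2 cosh z - 2
(`contourIntegral_eq_secondDiff`). Take r = k/(3n) with |r| ≤ 1. Then e^{-kr} = e^{-k²/(3n)}
outweighs the growth e^{nr²/2} = e^{k²/(18n)} of |φ|^n, while laziness gives |φ|^n an additional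
factor e^{-cnθ²} on all of [-π, π] (`norm_stepMGF_le`). The factor |2 cosh z - 2|^j ≤ (2r² + θ²)^j
is of order n^{-j} up to a small part of these exponentials, and integrating the Gaussian in θ
contributes n^{-1/2}. For |k| > 3n the differences vanish because the walk has range n. The grid
estimates follow by scaling; time zero is a support and size count. -/

instance isFiniteMeasure_stepLaw (ε : ℝ) : IsFiniteMeasure (stepLaw ε) := by
  have h (a : ℝ) (x : ℤ) : IsFiniteMeasure (ENNReal.ofReal a • Measure.dirac x) :=
    Measure.smul_finite _ ENNReal.ofReal_ne_top
  have h0 := h ε 0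
  have h1 := h ((1 - ε) / 2) 1
  have h2 := h ((1 - ε) / 2) (-1)
  unfold stepLaw
  infer_instance

instance isFiniteMeasure_walkLaw (ε : ℝ) (n : ℕ) : IsFiniteMeasure (walkLaw ε n) := by
  induction n with
  | zero => unfold walkLaw; infer_instance
  | succ n ih => unfold walkLaw; infer_instance

theorem kernel_zero (ε : ℝ) (k : ℤ) : kernel ε 0 k = if k = 0 then 1 else 0 := by
  unfold kernel walkLaw
  rw [measureReal_def, Measure.dirac_apply]
  by_cases hk : k = 0
  · simp [hk]
  · simp [hk, Ne.symm hk]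

theorem conv_smul_dirac_singleton (μ : Measure ℤ) [IsFiniteMeasure μ] {a : ℝ} (x k : ℤ) :
    (μ.conv (ENNReal.ofReal a • Measure.dirac x)) {k} = ENNReal.ofReal a * μ {k - x} := by
  have h1 : IsFiniteMeasure (ENNReal.ofReal a • Measure.dirac x : Measure ℤ) :=
    Measure.smul_finite _ ENNReal.ofReal_ne_top
  rw [Measure.conv_comm, Measure.conv_smul_left, Measure.dirac_conv, Measure.smul_apply,
    Measure.map_apply (by fun_prop) (measurableSet_singleton k), smul_eq_mul]
  congr 2
  ext y
  simp only [mem_preimage, mem_singleton_iff]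
  omega

theorem kernel_succ {ε : ℝ} (hε0 : 0 ≤ ε) (hε1 : ε ≤ 1) (n : ℕ) (k : ℤ) :
    kernel ε (n + 1) k
      = ε * kernel ε n k + (1 - ε) / 2 * (kernel ε n (k - 1) + kernel ε n (k + 1)) := by
  have hfin (a : ℝ) (x : ℤ) : IsFiniteMeasure (ENNReal.ofReal a • Measure.dirac x) :=
    Measure.smul_finite _ ENNReal.ofReal_ne_top
  have h0 := hfin ε 0
  have h1 := hfin ((1 - ε) / 2) 1
  have h2 := hfin ((1 - ε) / 2) (-1)
  have ha : 0 ≤ (1 - ε) / 2 := by linarith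
  have key : walkLaw ε (n + 1) {k} = ENNReal.ofReal ε * walkLaw ε n {k}
      + ENNReal.ofReal ((1 - ε) / 2) * walkLaw ε n {k - 1}
      + ENNReal.ofReal ((1 - ε) / 2) * walkLaw ε n {k + 1} := by
    change ((walkLaw ε n).conv (stepLaw ε)) {k} = _
    unfold stepLaw
    rw [Measure.conv_add, Measure.conv_add, Measure.add_apply, Measure.add_apply,
      conv_smul_dirac_singleton, conv_smul_dirac_singleton, conv_smul_dirac_singleton, sub_zero,
      sub_neg_eq_add]
  have hne (b : ℝ) (x : ℤ) : ENNReal.ofReal b * walkLaw ε n {x} ≠ ⊤ :=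
    ENNReal.mul_ne_top ENNReal.ofReal_ne_top (measure_ne_top _ _)
  simp only [kernel, measureReal_def]
  rw [key, ENNReal.toReal_add (ENNReal.add_ne_top.2 ⟨hne _ _, hne _ _⟩) (hne _ _),
    ENNReal.toReal_add (hne _ _) (hne _ _), ENNReal.toReal_mul, ENNReal.toReal_mul,
    ENNReal.toReal_mul, ENNReal.toReal_ofReal hε0, ENNReal.toReal_ofReal ha]
  ring

theorem kernel_eq_zero_of_lt {ε : ℝ} (hε0 : 0 ≤ ε) (hε1 : ε ≤ 1) {n : ℕ} {k : ℤ}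
    (hk : (n : ℤ) < |k|) : kernel ε n k = 0 := by
  induction n generalizing k with
  | zero =>
    have : k ≠ 0 := by rintro rfl; simp at hk
    simp [kernel_zero, this]
  | succ n ih =>
    push_cast at hk
    rw [kernel_succ hε0 hε1, ih (by grind), ih (by grind), ih (by grind)]
    simp

/-! ### Fourier representation along shifted contours -/

/-- The moment generating function `E[e^{zξ}]` of one step at complex arguments. -/
noncomputable def stepMGF (ε : ℝ) (z : ℂ) : ℂ := ε + (1 - ε) * Complex.cosh z

/-- The integral over the segment `r + i[-π, π]` of
`(2 cosh z - 2) ^ j * E[e^{zξ}] ^ n * e^{-kz}`. -/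
noncomputable def contourIntegral (ε r : ℝ) (j n : ℕ) (k : ℤ) : ℂ :=
  ∫ θ in (-Real.pi)..Real.pi, (2 * Complex.cosh (r + θ * Complex.I) - 2) ^ j
    * stepMGF ε (r + θ * Complex.I) ^ n * Complex.exp (-(k * (r + θ * Complex.I)))

theorem intervalIntegrable_contour (ε r : ℝ) (j n : ℕ) (k : ℤ) (a b : ℝ) :
    IntervalIntegrable (fun θ : ℝ => (2 * Complex.cosh (r + θ * Complex.I) - 2) ^ j
      * stepMGF ε (r + θ * Complex.I) ^ n * Complex.exp (-(k * (r + θ * Complex.I))))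
      volume a b := by
  apply Continuous.intervalIntegrable
  have h : Continuous fun θ : ℝ => Complex.cosh (r + θ * Complex.I) :=
    Complex.continuous_cosh.comp (by fun_prop)
  unfold stepMGF
  fun_prop

theorem cosh_mul_exp_neg_mul (k : ℤ) (z : ℂ) :
    2 * Complex.cosh z * Complex.exp (-(k * z))
      = Complex.exp (-((k + 1 : ℤ) * z)) + Complex.exp (-((k - 1 : ℤ) * z)) := by
  rw [Complex.two_cosh, add_mul, ← Complex.exp_add, ← Complex.exp_add, add_comm]
  congr 2 <;> push_cast <;> ring

theorem contourIntegral_gradient_succ (ε r : ℝ) (j n : ℕ) (k : ℤ) :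
    contourIntegral ε r (j + 1) n k = contourIntegral ε r j n (k + 1)
      + contourIntegral ε r j n (k - 1) - 2 * contourIntegral ε r j n k := by
  unfold contourIntegral
  rw [← intervalIntegral.integral_const_mul, ← intervalIntegral.integral_add,
    ← intervalIntegral.integral_sub]
  · congr 1
    ext θ
    rw [← mul_add, ← cosh_mul_exp_neg_mul]
    ring
  · exact (intervalIntegrable_contour ..).add (intervalIntegrable_contour ..)
  · exact (intervalIntegrable_contour ..).const_mul _
  · exact intervalIntegrable_contour ..
  · exact intervalIntegrable_contour ..

theorem contourIntegral_time_succ (ε r : ℝ) (j n : ℕ) (k : ℤ) :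
    contourIntegral ε r j (n + 1) k = ε * contourIntegral ε r j n k
      + (1 - ε) / 2 * (contourIntegral ε r j n (k - 1) + contourIntegral ε r j n (k + 1)) := by
  unfold contourIntegral
  rw [← intervalIntegral.integral_add, ← intervalIntegral.integral_const_mul,
    ← intervalIntegral.integral_const_mul, ← intervalIntegral.integral_add]
  · congr 1
    ext θ
    rw [← mul_add, add_comm (Complex.exp _), ← cosh_mul_exp_neg_mul, pow_succ]
    nth_rewrite 2 [stepMGF]
    ring
  · exact (intervalIntegrable_contour ..).const_mul _
  · exact ((intervalIntegrable_contour ..).add (intervalIntegrable_contour ..)).const_mul _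
  · exact intervalIntegrable_contour ..
  · exact intervalIntegrable_contour ..

theorem contourIntegral_zero_zero (ε r : ℝ) (k : ℤ) :
    contourIntegral ε r 0 0 k = if k = 0 then 2 * Real.pi else 0 := by
  unfold contourIntegral
  by_cases hk : k = 0
  · simp [hk]
    ring
  · have hc : -((k : ℂ) * Complex.I) ≠ 0 := by simp [hk]
    have h (θ : ℝ) : Complex.exp (-(k * (r + θ * Complex.I)))
        = Complex.exp (-(k * r)) * Complex.exp (-((k : ℂ) * Complex.I) * θ) := by
      rw [← Complex.exp_add]
      ring_nf
    simp only [pow_zero, one_mul, h, hk, if_false]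
    rw [intervalIntegral.integral_const_mul, integral_exp_mul_complex hc]
    have hper : Complex.exp (-((k : ℂ) * Complex.I) * (Real.pi : ℝ))
        = Complex.exp (-((k : ℂ) * Complex.I) * ((-Real.pi : ℝ) : ℂ)) := by
      rw [Complex.exp_eq_exp_iff_exists_int]
      refine ⟨-k, ?_⟩
      push_cast
      ring
    rw [hper, sub_self, zero_div, mul_zero]
    simp

/-- Both sides satisfy the same recursion in n with the same initial value, for each r separately,
so no contour has to be deformed. -/
theorem contourIntegral_eq_kernel {ε : ℝ} (hε0 : 0 ≤ ε) (hε1 : ε ≤ 1) (r : ℝ) (n : ℕ) (k : ℤ) :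
    contourIntegral ε r 0 n k = 2 * Real.pi * kernel ε n k := by
  induction n generalizing k with
  | zero => rw [contourIntegral_zero_zero, kernel_zero]; split_ifs <;> simp
  | succ n ih =>
    rw [contourIntegral_time_succ, kernel_succ hε0 hε1, ih, ih, ih]
    push_cast
    ring

/-! ### Pointwise bounds on the contour -/

theorem re_cosh_add_mul_I (r θ : ℝ) :
    (Complex.cosh (r + θ * Complex.I)).re = Real.cosh r * Real.cos θ := by
  rw [Complex.cosh_add, Complex.cosh_mul_I, Complex.sinh_mul_I, ← Complex.ofReal_cosh,
    ← Complex.ofReal_sinh, ← Complex.ofReal_cos, ← Complex.ofReal_sin]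
  simp [-Complex.ofReal_cosh, -Complex.ofReal_sinh, -Complex.ofReal_cos, -Complex.ofReal_sin]

theorem im_cosh_add_mul_I (r θ : ℝ) :
    (Complex.cosh (r + θ * Complex.I)).im = Real.sinh r * Real.sin θ := by
  rw [Complex.cosh_add, Complex.cosh_mul_I, Complex.sinh_mul_I, ← Complex.ofReal_cosh,
    ← Complex.ofReal_sinh, ← Complex.ofReal_cos, ← Complex.ofReal_sin]
  simp [-Complex.ofReal_cosh, -Complex.ofReal_sinh, -Complex.ofReal_cos, -Complex.ofReal_sin]

/-- This is 2 cosh z - 2 = 4 sinh²(z/2) in modulus. -/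
theorem norm_two_cosh_sub_two (r θ : ℝ) :
    ‖2 * Complex.cosh (r + θ * Complex.I) - 2‖ = 2 * Real.cosh r - 2 * Real.cos θ := by
  have h0 : 0 ≤ 2 * Real.cosh r - 2 * Real.cos θ := by
    linarith [Real.one_le_cosh r, Real.cos_le_one θ]
  rw [← sq_eq_sq₀ (norm_nonneg _) h0, ← Complex.normSq_eq_norm_sq, Complex.normSq_apply]
  simp only [Complex.sub_re, Complex.sub_im, Complex.mul_re, Complex.mul_im, Complex.re_ofNat,
    Complex.im_ofNat, re_cosh_add_mul_I, im_cosh_add_mul_I]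
  linear_combination (4 * Real.sin θ ^ 2) * (-Real.cosh_sq r)
    + 4 * (Real.cosh r ^ 2 - 1) * Real.sin_sq_add_cos_sq θ

theorem norm_two_cosh_sub_two_le {r : ℝ} (hr : |r| ≤ 1) (θ : ℝ) :
    ‖2 * Complex.cosh (r + θ * Complex.I) - 2‖ ≤ 2 * r ^ 2 + θ ^ 2 := by
  rw [norm_two_cosh_sub_two]
  have h1 := Real.cosh_le_exp_half_sq r
  have hr2 : r ^ 2 ≤ 1 := (sq_le_one_iff_abs_le_one r).2 hr
  have h2 : |Real.exp (r ^ 2 / 2) - 1| ≤ 2 * |r ^ 2 / 2| :=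
    Real.abs_exp_sub_one_le (by rw [abs_of_nonneg (by positivity)]; linarith)
  rw [abs_of_nonneg (show 0 ≤ r ^ 2 / 2 by positivity)] at h2
  have h3 := (abs_le.1 h2).2
  have h4 := Real.one_sub_sq_div_two_le_cos (x := θ)
  linarith

/-- Expanding |φ|², the cross term between staying and moving loses a multiple of ε(1 - ε)(1 - cos
θ), and 1 - cos θ ≥ 2θ²/π². With ε = 0 there is no decay near θ = ±π, by parity. -/
theorem norm_stepMGF_le {ε : ℝ} (hε0 : 0 ≤ ε) (hε1 : ε ≤ 1) {r θ : ℝ} (hr : |r| ≤ 1)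
    (hθ : |θ| ≤ Real.pi) :
    ‖stepMGF ε (r + θ * Complex.I)‖
      ≤ Real.exp (r ^ 2 / 2 - ε * (1 - ε) / Real.pi ^ 2 * θ ^ 2) := by
  have hcosh := Real.cosh_le_exp_half_sq r
  have hone := Real.one_le_cosh r
  have hr2 : r ^ 2 ≤ 1 := (sq_le_one_iff_abs_le_one r).2 hr
  have h2 : |Real.exp (r ^ 2 / 2) - 1| ≤ 2 * |r ^ 2 / 2| :=
    Real.abs_exp_sub_one_le (by rw [abs_of_nonneg (by positivity)]; linarith)
  rw [abs_of_nonneg (show 0 ≤ r ^ 2 / 2 by positivity)] at h2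
  have h3 := (abs_le.1 h2).2
  have hcos := Real.cos_le_one_sub_mul_cos_sq hθ
  set c := Real.cosh r with hc
  set M := ε + (1 - ε) * c with hM
  set v := 1 - Real.cos θ with hv
  have hv0 : 0 ≤ v := by linarith [Real.cos_le_one θ]
  have hMc : M ≤ c := by nlinarith
  have hM0 : 0 ≤ M := by nlinarith
  -- M ≤ c ≤ 1 + r² ≤ 2; this turns the loss into a factor of M².
  have hM2 : M ^ 2 ≤ 2 * c := by nlinarith
  have hb : 0 ≤ ε * (1 - ε) := mul_nonneg hε0 (by linarith)
  have hsq : ‖stepMGF ε (r + θ * Complex.I)‖ ^ 2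
      = M ^ 2 - 2 * (ε * (1 - ε)) * c * v - (1 - ε) ^ 2 * Real.sin θ ^ 2 := by
    rw [← Complex.normSq_eq_norm_sq, Complex.normSq_apply, stepMGF]
    simp only [Complex.add_re, Complex.add_im, Complex.sub_re, Complex.sub_im, Complex.mul_re,
      Complex.mul_im, Complex.ofReal_re, Complex.ofReal_im, Complex.one_re, Complex.one_im,
      re_cosh_add_mul_I, im_cosh_add_mul_I, ← hc]
    rw [hM, hv]
    linear_combination ((1 - ε) ^ 2 * Real.sin θ ^ 2) * (-Real.cosh_sq r)
      + (1 - ε) ^ 2 * c ^ 2 * Real.sin_sq_add_cos_sq θ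
  have hle : ‖stepMGF ε (r + θ * Complex.I)‖ ^ 2 ≤ M ^ 2 * (1 - ε * (1 - ε) * v) := by
    have h5 : ε * (1 - ε) * v * M ^ 2 ≤ ε * (1 - ε) * v * (2 * c) := by gcongr
    have h6 : 0 ≤ (1 - ε) ^ 2 * Real.sin θ ^ 2 := by positivity
    rw [hsq]
    linarith
  have hexp : 1 - ε * (1 - ε) * v ≤ Real.exp (-(2 * (ε * (1 - ε) / Real.pi ^ 2 * θ ^ 2))) := by
    have h7 : 2 / Real.pi ^ 2 * θ ^ 2 ≤ v := by linarith
    have h8 : ε * (1 - ε) * (2 / Real.pi ^ 2 * θ ^ 2) ≤ ε * (1 - ε) * v := by gcongr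
    have h9 := Real.add_one_le_exp (-(2 * (ε * (1 - ε) / Real.pi ^ 2 * θ ^ 2)))
    have h10 : 2 * (ε * (1 - ε) / Real.pi ^ 2 * θ ^ 2)
        = ε * (1 - ε) * (2 / Real.pi ^ 2 * θ ^ 2) := by ring
    linarith
  refine le_of_sq_le_sq ?_ (Real.exp_nonneg _)
  calc ‖stepMGF ε (r + θ * Complex.I)‖ ^ 2 ≤ M ^ 2 * (1 - ε * (1 - ε) * v) := hle
    _ ≤ Real.exp (r ^ 2 / 2) ^ 2
        * Real.exp (-(2 * (ε * (1 - ε) / Real.pi ^ 2 * θ ^ 2))) := by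
      -- These two bounds make 1 - ε(1 - ε)v nonnegative, as multiplying the inequalities requires.
      have hv2 : v ≤ 2 := by linarith [Real.neg_one_le_cos θ]
      have hb4 : ε * (1 - ε) ≤ 1 / 4 := by nlinarith [sq_nonneg (ε - 1 / 2)]
      gcongr
      · nlinarith
      · exact hMc.trans hcosh
    _ = Real.exp (r ^ 2 / 2 - ε * (1 - ε) / Real.pi ^ 2 * θ ^ 2) ^ 2 := by
      rw [← Real.exp_nat_mul, ← Real.exp_nat_mul, ← Real.exp_add]
      congr 1
      push_cast
      ring

theorem norm_contour_integrand_le {ε : ℝ} (hε0 : 0 < ε) (hε1 : ε < 1) (j : ℕ) {n : ℕ}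
    (hn : 0 < n) {k : ℤ} (hk : |k| ≤ 3 * n) {θ : ℝ} (hθ : |θ| ≤ Real.pi) :
    ‖(2 * Complex.cosh ((k / (3 * n) : ℝ) + θ * Complex.I) - 2) ^ j
        * stepMGF ε ((k / (3 * n) : ℝ) + θ * Complex.I) ^ n
        * Complex.exp (-(k * ((k / (3 * n) : ℝ) + θ * Complex.I)))‖
      ≤ (2 / (ε * (1 - ε) / Real.pi ^ 2)) ^ j * j.factorial / n ^ j
        * Real.exp (-((k : ℝ) ^ 2 / (6 * n)))
        * Real.exp (-(ε * (1 - ε) / Real.pi ^ 2 * n / 2) * θ ^ 2) := by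
  have hn' : (0 : ℝ) < n := by exact_mod_cast hn
  have hk' : |(k : ℝ)| ≤ 3 * n := by exact_mod_cast hk
  set r : ℝ := k / (3 * n) with hr
  set c : ℝ := ε * (1 - ε) / Real.pi ^ 2 with hc
  have hε : 0 < 1 - ε := by linarith
  have hc0 : 0 < c := by positivity
  have hc1 : c ≤ 1 := by
    rw [hc, div_le_one (by positivity)]
    nlinarith [Real.pi_gt_three]
  have hr1 : |r| ≤ 1 := by
    rw [hr, abs_div, abs_of_pos (show (0 : ℝ) < 3 * n by positivity),
      div_le_one (by positivity)]
    exact hk'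
  set y : ℝ := n * r ^ 2 with hy
  have hy0 : 0 ≤ y := by positivity
  have hky : (k : ℝ) * r = 3 * y := by rw [hy, hr]; field_simp
  have hky2 : (k : ℝ) ^ 2 / (6 * n) = 3 / 2 * y := by rw [hy, hr]; field_simp; ring
  -- Chosen so that e^s uses only half of the decay in θ, and at most y of the 5y/2 available, as c
  -- ≤ 1; 3y/2 = k²/(6n) remains.
  set s : ℝ := c * (2 * y + n * θ ^ 2) / 2 with hs
  have hs0 : 0 ≤ s := by positivity
  have h1 : ‖2 * Complex.cosh (r + θ * Complex.I) - 2‖ ≤ 2 / c / n * s := by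
    refine (norm_two_cosh_sub_two_le hr1 θ).trans_eq ?_
    rw [hs, hy]
    field_simp
  have h1' : ‖2 * Complex.cosh (r + θ * Complex.I) - 2‖ ^ j
      ≤ (2 / c) ^ j * j.factorial / n ^ j * Real.exp s := by
    have h := Real.pow_div_factorial_le_exp s hs0 j
    rw [div_le_iff₀ (by positivity)] at h
    calc ‖2 * Complex.cosh (r + θ * Complex.I) - 2‖ ^ j ≤ (2 / c / n * s) ^ j := by gcongr
      _ = (2 / c) ^ j / n ^ j * s ^ j := by rw [mul_pow, div_pow (2 / c)]
      _ ≤ (2 / c) ^ j / n ^ j * (Real.exp s * j.factorial) := by gcongr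
      _ = _ := by ring
  have h2 : ‖stepMGF ε (r + θ * Complex.I)‖ ^ n ≤ Real.exp (y / 2 - c * n * θ ^ 2) := by
    refine (pow_le_pow_left₀ (norm_nonneg _) (norm_stepMGF_le hε0.le hε1.le hr1 hθ) n).trans_eq ?_
    rw [← Real.exp_nat_mul, ← hc, hy]
    congr 1
    ring
  have h3 : ‖Complex.exp (-(k * (r + θ * Complex.I)))‖ = Real.exp (-(3 * y)) := by
    rw [Complex.norm_exp, ← hky]
    simp
  rw [norm_mul, norm_mul, norm_pow, norm_pow, h3, hky2]
  calc _ ≤ (2 / c) ^ j * j.factorial / n ^ j * Real.exp s * Real.exp (y / 2 - c * n * θ ^ 2)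
        * Real.exp (-(3 * y)) := by gcongr
    _ = (2 / c) ^ j * j.factorial / n ^ j
        * Real.exp (s + (y / 2 - c * n * θ ^ 2) + -(3 * y)) := by
      rw [Real.exp_add, Real.exp_add]; ring
    _ ≤ (2 / c) ^ j * j.factorial / n ^ j
        * Real.exp (-(3 / 2 * y) + -(c * n / 2) * θ ^ 2) := by
      refine mul_le_mul_of_nonneg_left (Real.exp_le_exp.2 ?_) (by positivity)
      rw [hs]
      nlinarith [mul_le_mul_of_nonneg_right hc1 hy0]
    _ = _ := by rw [Real.exp_add]; ring

theorem norm_contourIntegral_le {ε : ℝ} (hε0 : 0 < ε) (hε1 : ε < 1) (j : ℕ) {n : ℕ}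
    (hn : 0 < n) {k : ℤ} (hk : |k| ≤ 3 * n) :
    ‖contourIntegral ε (k / (3 * n)) j n k‖
      ≤ (2 / (ε * (1 - ε) / Real.pi ^ 2)) ^ j * j.factorial
        * √(2 * Real.pi / (ε * (1 - ε) / Real.pi ^ 2)) / (n ^ j * √n)
        * Real.exp (-((k : ℝ) ^ 2 / (6 * n))) := by
  have hn' : (0 : ℝ) < n := by exact_mod_cast hn
  have hpi := Real.pi_pos
  have hb (θ : ℝ) := norm_contour_integrand_le hε0 hε1 j hn hk (θ := θ)
  set c : ℝ := ε * (1 - ε) / Real.pi ^ 2 with hc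
  have hε : 0 < 1 - ε := by linarith
  have hc0 : 0 < c := by positivity
  set A : ℝ := (2 / c) ^ j * j.factorial / n ^ j * Real.exp (-((k : ℝ) ^ 2 / (6 * n))) with hA
  have hA0 : 0 ≤ A := by positivity
  have hint : Integrable fun θ : ℝ => A * Real.exp (-(c * n / 2) * θ ^ 2) :=
    (integrable_exp_neg_mul_sq (by positivity)).const_mul A
  unfold contourIntegral
  calc _ ≤ ∫ θ in (-Real.pi)..Real.pi, A * Real.exp (-(c * n / 2) * θ ^ 2) := by
        refine intervalIntegral.norm_integral_le_of_norm_le (by linarith) ?_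
          hint.intervalIntegrable
        exact Filter.Eventually.of_forall fun θ hθ => hb θ (abs_le.2 ⟨hθ.1.le, hθ.2⟩)
    _ ≤ ∫ θ : ℝ, A * Real.exp (-(c * n / 2) * θ ^ 2) := by
        rw [intervalIntegral.integral_of_le (by linarith)]
        exact setIntegral_le_integral hint
          (Filter.Eventually.of_forall fun θ => by positivity)
    _ = A * √(2 * Real.pi / c / n) := by
        rw [integral_const_mul, integral_gaussian]
        congr 2
        field_simp
    _ = _ := by
        rw [Real.sqrt_div (by positivity), hA]
        field_simp

/-! ### Discrete gradients of the transition function -/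

/-- The iterated second difference on `ℤ`. -/
def secondDiff : ℕ → (ℤ → ℝ) → ℤ → ℝ
  | 0, f => f
  | j + 1, f => fun k =>
      secondDiff j f (k + 1) + secondDiff j f (k - 1) - 2 * secondDiff j f k

/-- Each second difference widens the support by one on either side. -/
theorem secondDiff_eq_zero {f : ℤ → ℝ} {n : ℤ} (hf : ∀ k, n < |k| → f k = 0) (j : ℕ) {k : ℤ}
    (hk : n + j < |k|) : secondDiff j f k = 0 := by
  induction j generalizing k with
  | zero => exact hf k (by simpa using hk)
  | succ j ih =>
    push_cast at hk
    simp only [secondDiff]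
    rw [ih (by grind), ih (by grind), ih (by grind)]
    simp

theorem contourIntegral_eq_secondDiff {ε : ℝ} (hε0 : 0 ≤ ε) (hε1 : ε ≤ 1) (r : ℝ) (j n : ℕ)
    (k : ℤ) :
    contourIntegral ε r j n k = 2 * Real.pi * secondDiff j (kernel ε n) k := by
  induction j generalizing k with
  | zero => exact contourIntegral_eq_kernel hε0 hε1 r n k
  | succ j ih =>
    rw [contourIntegral_gradient_succ, ih, ih, ih, secondDiff]
    push_cast
    ring

/-- Gaussian bound for the differences of order at most four of the transition function. -/
theorem exists_abs_secondDiff_kernel_le {ε : ℝ} (hε0 : 0 < ε) (hε1 : ε < 1) {j : ℕ} (hj : j ≤ 2) :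
    ∃ C : ℝ, 0 < C ∧ ∀ n : ℕ, 0 < n → ∀ k : ℤ,
      |secondDiff j (kernel ε n) k|
        ≤ C / (n ^ j * √n) * Real.exp (-((k : ℝ) ^ 2 / (6 * n))) := by
  have hpi := Real.pi_pos
  have hε : 0 < 1 - ε := by linarith
  refine ⟨(2 / (ε * (1 - ε) / Real.pi ^ 2)) ^ j * j.factorial
        * √(2 * Real.pi / (ε * (1 - ε) / Real.pi ^ 2)), by positivity, fun n hn k => ?_⟩
  rcases le_or_gt |k| (3 * n) with hk | hk
  · have h := norm_contourIntegral_le hε0 hε1 j hn hk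
    rw [contourIntegral_eq_secondDiff hε0.le hε1.le, ← Complex.ofReal_ofNat,
      ← Complex.ofReal_mul, ← Complex.ofReal_mul, Complex.norm_real, Real.norm_eq_abs, abs_mul,
      abs_of_pos (show 0 < 2 * Real.pi by positivity)] at h
    refine le_trans ?_ h
    exact le_mul_of_one_le_left (abs_nonneg _) (by linarith [Real.pi_gt_three])
  -- Here j ≤ 2 and n ≥ 1 give n + j ≤ 3n < |k|.
  · rw [secondDiff_eq_zero (n := n) (fun k hk => kernel_eq_zero_of_lt hε0.le hε1.le hk) j
      (by omega), abs_zero]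
    positivity

/-! ### Rescaling to the grid, and time zero -/

theorem rescaledKernel_grid_add (ε : ℝ) {δ : ℝ} (hδ : 0 < δ) (n : ℕ) (k l : ℤ) {x : ℝ}
    (hx : x = δ * (k : ℝ) + l * δ) :
    rescaledKernel ε δ (δ ^ 2 * (n : ℝ)) x = 1 / δ * kernel ε n (k + l) := by
  rw [← rescaledKernel_grid ε hδ, hx]
  congr 1
  push_cast
  ring

theorem grad2_rescaledKernel (ε : ℝ) {δ : ℝ} (hδ : 0 < δ) (n : ℕ) (k : ℤ) :
    grad2 δ (rescaledKernel ε δ (δ ^ 2 * (n : ℝ))) (δ * (k : ℝ))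
      = 1 / δ ^ 3 * secondDiff 1 (kernel ε n) k := by
  simp only [grad2, secondDiff]
  rw [rescaledKernel_grid ε hδ,
    rescaledKernel_grid_add ε hδ n k 1 (by push_cast; ring),
    rescaledKernel_grid_add ε hδ n k (-1) (by push_cast; ring), ← sub_eq_add_neg]
  field_simp

theorem grad4_rescaledKernel (ε : ℝ) {δ : ℝ} (hδ : 0 < δ) (n : ℕ) (k : ℤ) :
    grad4 δ (rescaledKernel ε δ (δ ^ 2 * (n : ℝ))) (δ * (k : ℝ))
      = 1 / δ ^ 5 * secondDiff 2 (kernel ε n) k := by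
  simp only [grad4, secondDiff]
  rw [rescaledKernel_grid ε hδ,
    rescaledKernel_grid_add ε hδ n k 1 (x := δ * k + δ) (by push_cast; ring),
    rescaledKernel_grid_add ε hδ n k 2 (x := δ * k + 2 * δ) (by push_cast; ring),
    rescaledKernel_grid_add ε hδ n k (-1) (x := δ * k - δ) (by push_cast; ring),
    rescaledKernel_grid_add ε hδ n k (-2) (x := δ * k - 2 * δ) (by push_cast; ring),
    sub_add_cancel, add_sub_cancel_right, add_assoc k, sub_sub k, one_add_one_eq_two,
    ← sub_eq_add_neg, ← sub_eq_add_neg]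
  field_simp
  ring

theorem mul_rpow_half (δ : ℝ) (hδ : 0 < δ) (n j : ℕ) (hn : 0 < n) {p : ℝ}
    (hp : p = j + 1 / 2) :
    (δ ^ 2 * (n : ℝ)) ^ p = δ ^ (2 * j + 1) * (n ^ j * √n) := by
  have hn' : (0 : ℝ) < n := by exact_mod_cast hn
  rw [hp, Real.rpow_add (by positivity), Real.rpow_natCast, ← Real.sqrt_eq_rpow,
    Real.sqrt_mul (by positivity), Real.sqrt_sq hδ.le]
  ring

theorem scaled_gaussian_bound {D C δ p : ℝ} (hδ : 0 < δ) {n : ℕ} (hn : 0 < n) (j : ℕ) (k : ℤ)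
    (hp : p = j + 1 / 2)
    (h : |D| ≤ C / (n ^ j * √n) * Real.exp (-((k : ℝ) ^ 2 / (6 * n)))) :
    |1 / δ ^ (2 * j + 1) * D| ≤ C / (δ ^ 2 * (n : ℝ)) ^ p
      * Real.exp (-(1 / 6 * (δ * (k : ℝ)) ^ 2 / (δ ^ 2 * (n : ℝ)))) := by
  have hn' : (0 : ℝ) < n := by exact_mod_cast hn
  have he : 1 / 6 * (δ * (k : ℝ)) ^ 2 / (δ ^ 2 * (n : ℝ)) = (k : ℝ) ^ 2 / (6 * n) := by
    field_simp
  rw [mul_rpow_half δ hδ n j hn hp, he, abs_mul,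
    abs_of_pos (show 0 < 1 / δ ^ (2 * j + 1) by positivity)]
  calc _ ≤ 1 / δ ^ (2 * j + 1) * (C / (n ^ j * √n) * Real.exp (-((k : ℝ) ^ 2 / (6 * n)))) := by
        gcongr
    _ = _ := by field_simp

theorem scaled_indicator_bound {f : ℤ → ℝ} {B δ : ℝ} (hδ : 0 < δ) (j m : ℕ)
    (hB : ∀ k, |f k| ≤ B) (hf : ∀ k : ℤ, (j : ℤ) < |k| → f k = 0) (k : ℤ) :
    |1 / δ ^ m * f k|
      ≤ B / δ ^ m * Set.indicator {v : ℝ | |v| ≤ j * δ} (fun _ => (1 : ℝ)) (δ * (k : ℝ)) := by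
  have hmem : δ * (k : ℝ) ∈ {v : ℝ | |v| ≤ j * δ} ↔ |k| ≤ j := by
    rw [mem_ofPred_eq, abs_mul, abs_of_pos hδ, mul_comm, mul_le_mul_iff_left₀ hδ]
    exact_mod_cast Iff.rfl
  by_cases hk : |k| ≤ j
  · rw [indicator_of_mem (hmem.2 hk), abs_mul, abs_of_pos (show 0 < 1 / δ ^ m by positivity),
      mul_one, one_div_mul_eq_div]
    gcongr
    exact hB k
  · rw [hf k (not_le.1 hk), indicator_of_notMem (mt hmem.1 hk)]
    simp

/-- The weights 1, 1, -2 have total absolute value 4. -/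
theorem abs_secondDiff_le {f : ℤ → ℝ} (hf : ∀ k, |f k| ≤ 1) (j : ℕ) (k : ℤ) :
    |secondDiff j f k| ≤ 4 ^ j := by
  induction j generalizing k with
  | zero => simpa [secondDiff] using hf k
  | succ j ih =>
    have h1 := abs_le.1 (ih (k + 1))
    have h2 := abs_le.1 (ih (k - 1))
    have h3 := abs_le.1 (ih k)
    rw [secondDiff, pow_succ, abs_le]
    constructor <;> linarith

theorem secondDiff_kernel_zero_bound {ε δ : ℝ} (hδ : 0 < δ) (j m : ℕ) (k : ℤ) :
    |1 / δ ^ m * secondDiff j (kernel ε 0) k| ≤ 4 ^ j / δ ^ m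
      * Set.indicator {v : ℝ | |v| ≤ j * δ} (fun _ => (1 : ℝ)) (δ * (k : ℝ)) := by
  have h1 (k : ℤ) : |kernel ε 0 k| ≤ 1 := by
    rw [kernel_zero]
    split_ifs <;> simp
  have h0 (k : ℤ) (hk : 0 < |k|) : kernel ε 0 k = 0 := by
    rw [kernel_zero, if_neg (abs_pos.1 hk)]
  exact scaled_indicator_bound hδ j m (abs_secondDiff_le h1 j)
    (fun l hl => secondDiff_eq_zero h0 j (by simpa using hl)) k

end LazyWalk

theorem mainTheorem7 (ε : ℝ) (hε0 : 0 < ε) (hε1 : ε < 1) :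
    (∃ C₁ C₂ C : ℝ, 0 < C₁ ∧ 0 < C₂ ∧ 0 < C ∧ ∀ δ : ℝ, 0 < δ →
      (∀ t ∈ LazyWalk.timeGrid δ, 0 < t → ∀ u ∈ LazyWalk.spaceGrid δ,
        |LazyWalk.grad2 δ (LazyWalk.rescaledKernel ε δ t) u|
          ≤ C₁ / t ^ ((3 : ℝ) / 2) * Real.exp (-(C₂ * u ^ 2 / t))) ∧
      (∀ u ∈ LazyWalk.spaceGrid δ,
        |LazyWalk.grad2 δ (LazyWalk.rescaledKernel ε δ 0) u|
          ≤ C / δ ^ 3 * Set.indicator {v : ℝ | |v| ≤ δ} (fun _ => (1 : ℝ)) u)) ∧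
    (∃ C₁ C₂ C : ℝ, 0 < C₁ ∧ 0 < C₂ ∧ 0 < C ∧ ∀ δ : ℝ, 0 < δ →
      (∀ t ∈ LazyWalk.timeGrid δ, 0 < t → ∀ u ∈ LazyWalk.spaceGrid δ,
        |LazyWalk.grad4 δ (LazyWalk.rescaledKernel ε δ t) u|
          ≤ C₁ / t ^ ((5 : ℝ) / 2) * Real.exp (-(C₂ * u ^ 2 / t))) ∧
      (∀ u ∈ LazyWalk.spaceGrid δ,
        |LazyWalk.grad4 δ (LazyWalk.rescaledKernel ε δ 0) u|
          ≤ C / δ ^ 5 * Set.indicator {v : ℝ | |v| ≤ 2 * δ} (fun _ => (1 : ℝ)) u)) := by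
  have hpos {δ : ℝ} {n : ℕ} (h : 0 < δ ^ 2 * (n : ℝ)) : 0 < n := by
    rcases Nat.eq_zero_or_pos n with rfl | hn
    · simp at h
    · exact hn
  constructor
  · obtain ⟨C₁, hC₁, hbound⟩ :=
      LazyWalk.exists_abs_secondDiff_kernel_le hε0 hε1 (show 1 ≤ 2 by norm_num)
    refine ⟨C₁, 1 / 6, 4 ^ 1, hC₁, by norm_num, by norm_num, fun δ hδ => ⟨?_, ?_⟩⟩
    · rintro _ ⟨n, rfl⟩ ht _ ⟨k, rfl⟩
      have hn : 0 < n := hpos ht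
      simp only [LazyWalk.grad2_rescaledKernel ε hδ]
      exact LazyWalk.scaled_gaussian_bound hδ hn 1 k (by norm_num) (hbound n hn k)
    · rintro _ ⟨k, rfl⟩
      have h := LazyWalk.grad2_rescaledKernel ε hδ 0 k
      rw [Nat.cast_zero, mul_zero] at h
      simp only [h]
      simpa using LazyWalk.secondDiff_kernel_zero_bound (ε := ε) hδ 1 3 k
  · obtain ⟨C₁, hC₁, hbound⟩ := LazyWalk.exists_abs_secondDiff_kernel_le hε0 hε1 le_rfl
    refine ⟨C₁, 1 / 6, 4 ^ 2, hC₁, by norm_num, by norm_num, fun δ hδ => ⟨?_, ?_⟩⟩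
    · rintro _ ⟨n, rfl⟩ ht _ ⟨k, rfl⟩
      have hn : 0 < n := hpos ht
      simp only [LazyWalk.grad4_rescaledKernel ε hδ]
      exact LazyWalk.scaled_gaussian_bound hδ hn 2 k (by norm_num) (hbound n hn k)
    · rintro _ ⟨k, rfl⟩
      have h := LazyWalk.grad4_rescaledKernel ε hδ 0 k
      rw [Nat.cast_zero, mul_zero] at h
      simp only [h]
      exact LazyWalk.secondDiff_kernel_zero_bound (ε := ε) hδ 2 5 k
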